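/- Let $a\le b\le c$ be integers with $a\ge 2$ and $\frac1a+\frac1b+\frac1c<1$. Let $\Delta=\Delta(a,b,c)\le \mathrm{PSL}_2(\mathbb R)$ be the triangle group generated by the rotations through $2\pi/a$, $2\pi/b$, $2\pi/c$ about the vertices of a hyperbolic triangle with angles $\pi/a,\pi/b,\pi/c$, let $\Delta^{(2)}\le \mathrm{SL}_2(\mathbb R)$ be the subgroup generated by $-1$ and all squares of elements of the preimage of $\Delta$ in $\mathrm{SL}_2(\mathbb R)$, let $E=\mathbb Q(\operatorname{Tr}\Delta^{(2)})$ be the invariant trace field (a totally real number field), and let $A\subseteq \mathrm M_2(\mathbb R)$ be the $E$-subalgebra generated by $\Delta^{(2)}$ (a quaternion algebra over $E$). Let $r\ge 1$ be an integer and suppose that $(a,b,c)$ is $r$-arithmetic: $A$ is split at exactly $r$ real places of $E$, that is, there are exactly $r$ field embeddings $\sigma\colon E\to\mathbb R$ with $A\otimes_{E,\sigma}\mathbb R\cong \mathrm M_2(\mathbb R)$ as $\mathbb R$-algebras. Let $q$ be the $r$th prime not dividing $2\operatorname{lcm}(a,b,c)$, i.e. $q$ is a prime with $q\nmid 2\operatorname{lcm}(a,b,c)$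 and there are exactly $r-1$ primes $p<q$ with $p\nmid 2\operatorname{lcm}(a,b,c)$. Then $$a<3q,\qquad b<6q^2,\qquad c<18q^4 .$$ -/

import Mathlib

open scoped MatrixGroups TensorProduct

noncomputable section

namespace TriangleGroup

/-- `χ(a,b,c) = 1/a + 1/b + 1/c - 1`; the triple is hyperbolic when this is negative. -/
def chi (a b c : ℕ) : ℝ := (1 / (a : ℝ) + 1 / (b : ℝ) + 1 / (c : ℝ)) - 1

/-- The lift to `SL₂(ℝ)` of the rotation of the upper half-plane about `i` through the angle
`2 * θ` (the Möbius transformation fixes `i` and has derivative `exp (2 * θ * i)` there). -/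
def rot (θ : ℝ) : SL(2, ℝ) :=
  ⟨!![Real.cos θ, Real.sin θ; -Real.sin θ, Real.cos θ], by
    rw [Matrix.det_fin_two_of]; nlinarith [Real.sin_sq_add_cos_sq θ]⟩

/-- The lift to `SL₂(ℝ)` of the translation `z ↦ exp d * z` along the imaginary axis, by the
hyperbolic distance `d`. -/
def transl (d : ℝ) : SL(2, ℝ) :=
  ⟨!![Real.exp (d / 2), 0; 0, Real.exp (-(d / 2))], by
    rw [Matrix.det_fin_two_of, ← Real.exp_add]; simp⟩

/-- The length of the side joining the vertices with angles `π/a` and `π/b` in the hyperbolic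
triangle with angles `π/a`, `π/b`, `π/c` (hyperbolic law of cosines for angles). -/
def sideLength (a b c : ℕ) : ℝ :=
  Real.arcosh ((Real.cos (Real.pi / a) * Real.cos (Real.pi / b) + Real.cos (Real.pi / c)) /
    (Real.sin (Real.pi / a) * Real.sin (Real.pi / b)))

/- Place the triangle `T(a,b,c)` with its vertex of angle `π/a` at `i` and its vertex of angle
`π/b` at `exp d * i`, where `d = sideLength a b c`. -/

/-- Lift of the rotation through `2π/a` about the vertex `i` of `T(a,b,c)`. -/
def deltaA (a : ℕ) : SL(2, ℝ) := rot (Real.pi / a)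

/-- Lift of the rotation through `2π/b` about the vertex `exp d * i` of `T(a,b,c)`. -/
def deltaB (a b c : ℕ) : SL(2, ℝ) :=
  transl (sideLength a b c) * rot (Real.pi / b) * (transl (sideLength a b c))⁻¹

/-- Lift of the rotation through `2π/c` about the third vertex; in `PSL₂(ℝ)` one has
`δ_a δ_b δ_c = 1`, and the lifts chosen here have traces `2 cos (π/a)`, `2 cos (π/b)`,
`2 cos (π/c)` and product `-1`. -/
def deltaC (a b c : ℕ) : SL(2, ℝ) := -(deltaA a * deltaB a b c)⁻¹

/-- The preimage in `SL₂(ℝ)` of the triangle group `Δ(a,b,c) ≤ PSL₂(ℝ)`, the group generated by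
the rotations through `2π/a`, `2π/b`, `2π/c` about the vertices of `T(a,b,c)`. -/
def Delta (a b c : ℕ) : Subgroup SL(2, ℝ) :=
  Subgroup.closure {-1, deltaA a, deltaB a b c, deltaC a b c}

/-- The subgroup `Δ⁽²⁾` generated by `-1` and all squares `δ²` with `δ ∈ Δ`. -/
def Delta2 (a b c : ℕ) : Subgroup SL(2, ℝ) :=
  Subgroup.closure ({-1} ∪ {g | ∃ δ ∈ Delta a b c, g = δ ^ 2})

/-- The invariant trace field `E = ℚ(Tr Δ⁽²⁾)`, as a subfield of `ℝ`. -/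
def invariantTraceField (a b c : ℕ) : IntermediateField ℚ ℝ :=
  IntermediateField.adjoin ℚ
    {x : ℝ | ∃ g ∈ Delta2 a b c, x = Matrix.trace (g : Matrix (Fin 2) (Fin 2) ℝ)}

/-- The quaternion algebra `A` of the triple: the `E`-subalgebra of `M₂(ℝ)` generated
by `Δ⁽²⁾`. -/
def quaternionAlg (a b c : ℕ) :
    Subalgebra (invariantTraceField a b c) (Matrix (Fin 2) (Fin 2) ℝ) :=
  Algebra.adjoin (invariantTraceField a b c)
    {M | ∃ g ∈ Delta2 a b c, M = (g : Matrix (Fin 2) (Fin 2) ℝ)}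

/-- A `K`-algebra `A` is split at the real embedding `σ : K → ℝ` if `A ⊗_{K,σ} ℝ` is isomorphic
to `M₂(ℝ)` as an `ℝ`-algebra. -/
def IsSplitAt {K : Type} [Field K] (A : Type) [Ring A] [Algebra K A] (σ : K →+* ℝ) : Prop :=
  letI : Algebra K ℝ := σ.toAlgebra
  Nonempty ((ℝ ⊗[K] A) ≃ₐ[ℝ] Matrix (Fin 2) (Fin 2) ℝ)

/-- The arithmetic dimension of `(a,b,c)`: the number of real places of `E`, that is, of field
embeddings `E → ℝ`, at which `A` is split. -/
def adim (a b c : ℕ) : ℕ :=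
  Set.ncard {σ : invariantTraceField a b c →+* ℝ | IsSplitAt (quaternionAlg a b c) σ}

/-- `q` is the `r`-th nondividing prime of `n` : `q` is a prime not dividing `n`, and exactly
`r - 1` primes `p < q` do not divide `n` (so `r ≥ 1`). -/
def IsNondividingPrime (n r q : ℕ) : Prop :=
  q.Prime ∧ ¬ q ∣ n ∧ Set.ncard {p : ℕ | p < q ∧ p.Prime ∧ ¬ p ∣ n} + 1 = r

end TriangleGroup

end

open scoped MatrixGroups TensorProduct Quaternion

noncomputable section

namespace TriangleGroup

/-! Write λ_s = 2cos(π/s) and m = lcm(a,b,c). The squares of δ_b and δ_c present A as a quaternion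
algebra over E with i² = ti - 1 and j² = κ, where κ is λ_b²λ_c² times `kappa 1 a b c`
(`exists_algEquiv_adjoin`, `commForm_sq_sq`). A is therefore split wherever κ becomes positive. E
lies in ℚ(2cos(π/m)), whose embeddings send λ_s to 2cos(kπ/s) for k prime to 2m, so a nonnegative
`kappa k a b c` gives a split place (`exists_isSplitAt`).

Let k run through 1 and the first r nondividing primes, all at most q. If 2q ≤ c, the resulting
embeddings differ at λ_c² - 2 ∈ E. If also every `kappa k a b c` were nonnegative, there would be r
+ 1 split places, a contradiction (`not_forall_kappa_nonneg`).

By `kappa_eq_mul`, the sign of `kappa` is that of a product of two sums of cosines. Each of a ≥ 3q;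
a < 3q with b ≥ 6q²; and ab ≤ 18q³ with c ≥ 18q⁴ makes the relevant angles small enough for
nonnegativity at all k ≤ q. -/

/-! ### Real splitting of quaternion algebras -/

/-- A quaternion algebra `ℍ[K, -1, t, κ]` with `t ^ 2 ≠ 4` is split at every real embedding
under which `κ` is positive. -/
theorem isSplitAt_of_algEquiv {K : Type} [Field K] {A : Type} [Ring A] [Algebra K A]
    (σ : K →+* ℝ) {t κ : K} (ht : t ^ 2 ≠ 4) (hκ : 0 < σ κ) (e : A ≃ₐ[K] ℍ[K, -1, t, κ]) :
    IsSplitAt A σ := by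
  let : Algebra K ℝ := σ.toAlgebra
  have hsm : ∀ (u : K) (M : Matrix (Fin 2) (Fin 2) ℝ), u • M = σ u • M := fun u M => rfl
  set s := √(σ κ) with hs
  have hs2 : s * s = σ κ := Real.mul_self_sqrt hκ.le
  have hs0 : s ≠ 0 := (Real.sqrt_pos.2 hκ).ne'
  set τ := σ t with hτ
  have hτ4 : τ ^ 2 ≠ 4 := by
    intro h
    apply ht
    apply σ.injective
    rw [map_pow, h, map_ofNat]
  -- `X` has trace τ and determinant 1, so X² = τX - 1; `J` has square σ(κ) and JX = τJ - XJ. These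
  -- are the defining relations of i and j.
  let X : Matrix (Fin 2) (Fin 2) ℝ := !![τ / 2, 1; τ ^ 2 / 4 - 1, τ / 2]
  let J : Matrix (Fin 2) (Fin 2) ℝ := !![s, 0; 0, -s]
  let q : QuaternionAlgebra.Basis (Matrix (Fin 2) (Fin 2) ℝ) (-1 : K) t κ :=
    { i := X, j := J, k := X * J
      i_mul_i := by
        rw [hsm, hsm]
        ext i j
        fin_cases i <;> fin_cases j <;>
          simp [X, Matrix.mul_apply, Fin.sum_univ_two, ← hτ] <;> ring
      j_mul_j := by
        rw [hsm, ← hs2]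
        ext i j
        fin_cases i <;> fin_cases j <;> simp [J, Matrix.mul_apply, Fin.sum_univ_two]
      i_mul_j := rfl
      j_mul_i := by
        rw [hsm]
        ext i j
        fin_cases i <;> fin_cases j <;>
          simp [X, J, Matrix.mul_apply, Fin.sum_univ_two, ← hτ] <;> ring }
  let ψ : A →ₐ[K] Matrix (Fin 2) (Fin 2) ℝ := q.liftHom.comp e.toAlgHom
  let Φ : ℝ ⊗[K] A →ₐ[ℝ] Matrix (Fin 2) (Fin 2) ℝ :=
    Algebra.TensorProduct.lift (Algebra.ofId ℝ _) ψ (fun r a => Algebra.commutes r _)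
  have hX : X ∈ Φ.range := ⟨1 ⊗ₜ e.symm ⟨0, 1, 0, 0⟩, by
    simp [Φ, ψ, q, QuaternionAlgebra.Basis.liftHom, QuaternionAlgebra.Basis.lift]⟩
  have hJ : J ∈ Φ.range := ⟨1 ⊗ₜ e.symm ⟨0, 0, 1, 0⟩, by
    simp [Φ, ψ, q, QuaternionAlgebra.Basis.liftHom, QuaternionAlgebra.Basis.lift]⟩
  have hsurj : Function.Surjective Φ := by
    intro M
    -- The lower left entry of `X` is nonzero exactly when τ² ≠ 4; then 1, X, J, XJ span, and
    -- equality of dimensions gives injectivity.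
    have hu : τ ^ 2 / 4 - 1 ≠ 0 := fun h => hτ4 (by linarith)
    set u := τ ^ 2 / 4 - 1 with hu'
    have hM : M = ((M 0 0 + M 1 1) / 2 - τ / 2 * ((M 0 1 + M 1 0 / u) / 2)) • (1 : Matrix _ _ ℝ)
        + ((M 0 1 + M 1 0 / u) / 2) • X
        + ((M 0 0 - M 1 1) / 2 / s - τ / 2 * ((M 1 0 / u - M 0 1) / 2 / s)) • J
        + ((M 1 0 / u - M 0 1) / 2 / s) • (X * J) := by
      ext i j
      fin_cases i <;> fin_cases j <;>
        simp [X, J, ← hu'] <;> field_simp <;> ring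
    have : M ∈ Φ.range := by
      rw [hM]
      exact add_mem (add_mem (add_mem (Subalgebra.smul_mem _ (one_mem _) _)
        (Subalgebra.smul_mem _ hX _)) (Subalgebra.smul_mem _ hJ _))
        (Subalgebra.smul_mem _ (mul_mem hX hJ) _)
    exact this
  have hA : Module.finrank K A = 4 := by
    rw [e.toLinearEquiv.finrank_eq, QuaternionAlgebra.finrank_eq_four]
  have : Module.Finite K A := Module.finite_of_finrank_pos (by omega)
  have hdim : Module.finrank ℝ (ℝ ⊗[K] A) = Module.finrank ℝ (Matrix (Fin 2) (Fin 2) ℝ) := by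
    rw [Module.finrank_baseChange, hA, Module.finrank_matrix]
    simp
  have hinj : Function.Injective Φ :=
    (LinearMap.injective_iff_surjective_of_finrank_eq_finrank (f := Φ.toLinearMap) hdim).2 hsurj
  exact ⟨AlgEquiv.ofBijective Φ ⟨hinj, hsurj⟩⟩

/-! ### Quaternion algebras generated by matrices of determinant 1 -/

/-- The determinant of the commutator of two matrices of determinant `1`, up to sign,
in terms of the traces of the matrices and of their product. -/
def commForm {R : Type*} [CommRing R] (u v w : R) : R := u ^ 2 + v ^ 2 + w ^ 2 - u * v * w - 4

section Generic

variable {R : Type*} [CommRing R] {x y : Matrix (Fin 2) (Fin 2) R}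

theorem mul_self_of_det_eq_one (hx : x.det = 1) : x * x = (-1 : R) • 1 + x.trace • x := by
  rw [Matrix.det_fin_two] at hx
  ext i j
  fin_cases i <;> fin_cases j <;>
    simp [Matrix.mul_apply, Fin.sum_univ_two, Matrix.trace_fin_two]
  · linear_combination -hx
  · ring
  · ring
  · linear_combination -hx

/-- A commutator has trace 0, so by Cayley–Hamilton its square is the scalar -det. -/
theorem commutator_mul_self (hx : x.det = 1) (hy : y.det = 1) :
    (x * y - y * x) * (x * y - y * x) =
      commForm x.trace y.trace (x * y).trace • (1 : Matrix (Fin 2) (Fin 2) R) := by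
  rw [Matrix.det_fin_two] at hx hy
  ext i j
  fin_cases i <;> fin_cases j <;>
    simp [Matrix.mul_apply, Fin.sum_univ_two, Matrix.trace_fin_two, commForm]
  · linear_combination ((x 0 0 + x 1 1) ^ 2 - 4 * (x 0 0 * x 1 1 - x 0 1 * x 1 0)) * hy
      + ((y 0 0 + y 1 1) ^ 2 - 4) * hx
  · ring
  · ring
  · linear_combination ((x 0 0 + x 1 1) ^ 2 - 4 * (x 0 0 * x 1 1 - x 0 1 * x 1 0)) * hy
      + ((y 0 0 + y 1 1) ^ 2 - 4) * hx

theorem commutator_mul_left :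
    (x * y - y * x) * x = x.trace • (x * y - y * x) - x * (x * y - y * x) := by
  ext i j
  fin_cases i <;> fin_cases j <;>
    simp [Matrix.mul_apply, Fin.sum_univ_two, Matrix.trace_fin_two] <;> ring

theorem trace_mul_commutator : (x * (x * y - y * x)).trace = 0 := by
  rw [mul_sub, Matrix.trace_sub, ← mul_assoc x y x, Matrix.trace_mul_comm (x * y) x, sub_self]

/-- Traces against `1`, `x`, `j`, `x * j` of a combination of `1`, `x`, `j`, `x * j`, where
`j = x * y - y * x`. -/
theorem trace_combination (hx : x.det = 1) (hy : y.det = 1) {M : Matrix (Fin 2) (Fin 2) R}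
    {p₀ p₁ p₂ p₃ : R} (hM : M = p₀ • (1 : Matrix (Fin 2) (Fin 2) R) + p₁ • x +
      p₂ • (x * y - y * x) + p₃ • (x * (x * y - y * x))) :
    M.trace = 2 * p₀ + x.trace * p₁ ∧
    (M * x).trace = x.trace * p₀ + (x.trace ^ 2 - 2) * p₁ ∧
    (M * (x * y - y * x)).trace =
      commForm x.trace y.trace (x * y).trace * (2 * p₂ + x.trace * p₃) ∧
    (M * (x * (x * y - y * x))).trace =
      commForm x.trace y.trace (x * y).trace * (x.trace * p₂ + 2 * p₃) := by
  have hxx := mul_self_of_det_eq_one hx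
  have hjj := commutator_mul_self hx hy
  have hjx := commutator_mul_left (x := x) (y := y)
  have hxj := trace_mul_commutator (x := x) (y := y)
  have hj : (x * y - y * x).trace = 0 := by
    rw [Matrix.trace_sub, Matrix.trace_mul_comm, sub_self]
  set t := x.trace with ht
  set κ := commForm x.trace y.trace (x * y).trace
  generalize x * y - y * x = j at *
  have h1 : (1 : Matrix (Fin 2) (Fin 2) R).trace = 2 := by simp
  have e1 : j * (x * j) = κ • (t • 1 - x) := by
    rw [← mul_assoc, hjx, sub_mul, smul_mul_assoc, mul_assoc, hjj, smul_sub, mul_smul_comm,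
      mul_one, smul_comm]
  have e2 : x * j * (x * j) = κ • 1 := by
    rw [mul_assoc, e1, mul_smul_comm, mul_sub, mul_smul_comm, mul_one, hxx]
    congr 1
    module
  have e3 : x * (x * j) = t • (x * j) - j := by
    rw [← mul_assoc, hxx, add_mul, smul_mul_assoc, smul_mul_assoc, one_mul]
    module
  have e4 : x * j * x = j := by
    rw [mul_assoc, hjx, mul_sub, mul_smul_comm, e3]
    module
  refine ⟨?_, ?_, ?_, ?_⟩
  · rw [hM]
    simp only [Matrix.trace_add, Matrix.trace_smul, smul_eq_mul, h1, hxj, hj, ← ht]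
    ring
  · rw [hM]
    simp only [add_mul, smul_mul_assoc, one_mul, hxx, hjx, e4, Matrix.trace_add,
      Matrix.trace_sub, Matrix.trace_smul, smul_eq_mul, h1, hxj, hj, ← ht]
    ring
  · rw [hM]
    simp only [add_mul, smul_mul_assoc, one_mul, hjj, mul_assoc, mul_smul_comm, mul_one,
      Matrix.trace_add, Matrix.trace_smul, smul_eq_mul, h1, hxj, hj, ← ht]
    ring
  · rw [hM]
    simp only [add_mul, smul_mul_assoc, one_mul, e1, e2, e3, Matrix.trace_add,
      Matrix.trace_sub, Matrix.trace_smul, smul_eq_mul, h1, hxj, hj, ← ht]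
    ring

end Generic

section Real

variable {x y : Matrix (Fin 2) (Fin 2) ℝ}

/-- The Gram matrix of the trace form on 1, x, j, xj splits into two 2×2 blocks, of determinants t²
- 4 and κ²(4 - t²), both nonzero here. -/
theorem eq_zero_of_combination_eq_zero (hx : x.det = 1) (hy : y.det = 1)
    (ht : x.trace ^ 2 ≠ 4) (hκ : commForm x.trace y.trace (x * y).trace ≠ 0) {p₀ p₁ p₂ p₃ : ℝ}
    (h : p₀ • (1 : Matrix (Fin 2) (Fin 2) ℝ) + p₁ • x +
      p₂ • (x * y - y * x) + p₃ • (x * (x * y - y * x)) = 0) :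
    p₀ = 0 ∧ p₁ = 0 ∧ p₂ = 0 ∧ p₃ = 0 := by
  obtain ⟨h0, h1, h2, h3⟩ := trace_combination hx hy h.symm
  simp only [zero_mul, Matrix.trace_zero] at h0 h1 h2 h3
  have h2' := (mul_eq_zero.1 h2.symm).resolve_left hκ
  have h3' := (mul_eq_zero.1 h3.symm).resolve_left hκ
  have ht' : x.trace ^ 2 - 4 ≠ 0 := sub_ne_zero.2 ht
  have hp1 : p₁ = 0 := by
    refine (mul_eq_zero.1 (?_ : (x.trace ^ 2 - 4) * p₁ = 0)).resolve_left ht'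
    linear_combination x.trace * h0 - 2 * h1
  have hp3 : p₃ = 0 := by
    refine (mul_eq_zero.1 (?_ : (x.trace ^ 2 - 4) * p₃ = 0)).resolve_left ht'
    linear_combination x.trace * h2' - 2 * h3'
  subst hp1 hp3
  refine ⟨by linarith, rfl, by linarith, rfl⟩

theorem exists_combination (hx : x.det = 1) (hy : y.det = 1)
    (ht : x.trace ^ 2 ≠ 4) (hκ : commForm x.trace y.trace (x * y).trace ≠ 0)
    (M : Matrix (Fin 2) (Fin 2) ℝ) :
    ∃ p₀ p₁ p₂ p₃ : ℝ, M = p₀ • (1 : Matrix (Fin 2) (Fin 2) ℝ) + p₁ • x +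
      p₂ • (x * y - y * x) + p₃ • (x * (x * y - y * x)) := by
  let f : (Fin 4 → ℝ) →ₗ[ℝ] Matrix (Fin 2) (Fin 2) ℝ :=
    Fintype.linearCombination ℝ ![1, x, x * y - y * x, x * (x * y - y * x)]
  have hf : ∀ p, f p = p 0 • (1 : Matrix (Fin 2) (Fin 2) ℝ) + p 1 • x +
      p 2 • (x * y - y * x) + p 3 • (x * (x * y - y * x)) := fun p => by
    simp [f, Fintype.linearCombination_apply, Fin.sum_univ_four]
  have hinj : Function.Injective f := by
    rw [injective_iff_map_eq_zero]
    intro p hp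
    rw [hf] at hp
    obtain ⟨h0, h1, h2, h3⟩ := eq_zero_of_combination_eq_zero hx hy ht hκ hp
    ext i
    fin_cases i <;> assumption
  have hsurj : Function.Surjective f :=
    (LinearMap.injective_iff_surjective_of_finrank_eq_finrank
      (by simp [Module.finrank_matrix])).1 hinj
  obtain ⟨p, hp⟩ := hsurj M
  exact ⟨p 0, p 1, p 2, p 3, by rw [← hp, hf]⟩

end Real

/-- The algebra generated over a field `E` of traces by a group of real matrices of determinant
`1` is a quaternion algebra, once two elements `x`, `y` of the group generate `M₂(ℝ)`. -/
theorem exists_algEquiv_adjoin {E : IntermediateField ℚ ℝ} {G : Subgroup SL(2, ℝ)}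
    (hG : ∀ g ∈ G, Matrix.trace (g : Matrix (Fin 2) (Fin 2) ℝ) ∈ E) {x y : SL(2, ℝ)}
    (hx : x ∈ G) (hy : y ∈ G) {t κ : E} (ht : (t : ℝ) = Matrix.trace x.1)
    (hκ : (κ : ℝ) = commForm (Matrix.trace x.1) (Matrix.trace y.1) (Matrix.trace (x.1 * y.1)))
    (ht4 : t ^ 2 ≠ 4) (hκ0 : κ ≠ 0) :
    Nonempty (Algebra.adjoin E {M | ∃ g ∈ G, M = (g : Matrix (Fin 2) (Fin 2) ℝ)} ≃ₐ[E]
      ℍ[E, -1, t, κ]) := by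
  have hsm : ∀ (u : E) (M : Matrix (Fin 2) (Fin 2) ℝ), u • M = (u : ℝ) • M := fun u M => rfl
  have hx1 := x.2
  have hy1 := y.2
  have ht4' : (Matrix.trace x.1) ^ 2 ≠ 4 := by
    rw [← ht]
    exact fun h => ht4 (Subtype.ext h)
  have hκ0' : commForm (Matrix.trace x.1) (Matrix.trace y.1) (Matrix.trace (x.1 * y.1)) ≠ 0 := by
    rw [← hκ]
    exact_mod_cast hκ0
  let q : QuaternionAlgebra.Basis (Matrix (Fin 2) (Fin 2) ℝ) (-1 : E) t κ :=
    { i := x.1, j := x.1 * y.1 - y.1 * x.1, k := x.1 * (x.1 * y.1 - y.1 * x.1)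
      i_mul_i := by
        rw [hsm, hsm, ht, mul_self_of_det_eq_one hx1]
        simp
      j_mul_j := by rw [hsm, hκ, commutator_mul_self hx1 hy1]
      i_mul_j := rfl
      j_mul_i := by rw [hsm, ht, commutator_mul_left] }
  have hq : ∀ p : ℍ[E, -1, t, κ], q.liftHom p =
      (p.re : ℝ) • (1 : Matrix (Fin 2) (Fin 2) ℝ) + (p.imI : ℝ) • x.1 +
      (p.imJ : ℝ) • (x.1 * y.1 - y.1 * x.1) +
      (p.imK : ℝ) • (x.1 * (x.1 * y.1 - y.1 * x.1)) := by
    intro p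
    simp only [← hsm]
    simp [QuaternionAlgebra.Basis.liftHom, QuaternionAlgebra.Basis.lift, q,
      Algebra.algebraMap_eq_smul_one]
  have hinj : Function.Injective q.liftHom := by
    rw [injective_iff_map_eq_zero]
    intro p hp
    rw [hq] at hp
    obtain ⟨h0, h1, h2, h3⟩ := eq_zero_of_combination_eq_zero hx1 hy1 ht4' hκ0' hp
    ext
    · simpa using h0
    · simpa using h1
    · simpa using h2
    · simpa using h3
  have hrange : q.liftHom.range =
      Algebra.adjoin E {M | ∃ g ∈ G, M = (g : Matrix (Fin 2) (Fin 2) ℝ)} := by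
    have hmem : ∀ g ∈ G, g.1 ∈ Algebra.adjoin E
        {M | ∃ g ∈ G, M = (g : Matrix (Fin 2) (Fin 2) ℝ)} := fun g hg =>
      Algebra.subset_adjoin ⟨g, hg, rfl⟩
    apply le_antisymm
    · have hj := sub_mem (mul_mem (hmem x hx) (hmem y hy)) (mul_mem (hmem y hy) (hmem x hx))
      rw [QuaternionAlgebra.Basis.range_liftHom, Algebra.adjoin_le_iff]
      rintro M (rfl | rfl | rfl)
      · exact hmem x hx
      · exact hj
      · exact mul_mem (hmem x hx) hj
    · rw [Algebra.adjoin_le_iff]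
      rintro _ ⟨g, hg, rfl⟩
      -- The coordinates of g are a priori real. Pairing g with the basis under the trace gives a
      -- nonsingular linear system over E, so they lie in E.
      obtain ⟨p₀, p₁, p₂, p₃, hp⟩ := exists_combination hx1 hy1 ht4' hκ0' g.1
      obtain ⟨e0, e1, e2, e3⟩ := trace_combination hx1 hy1 hp
      have m0 := hG g hg
      have m1 := hG _ (mul_mem hg hx)
      have m2 : (g.1 * (x.1 * y.1 - y.1 * x.1)).trace ∈ E := by
        have := sub_mem (hG _ (mul_mem hg (mul_mem hx hy))) (hG _ (mul_mem hg (mul_mem hy hx)))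
        simpa [mul_sub, Matrix.trace_sub] using this
      have m3 : (g.1 * (x.1 * (x.1 * y.1 - y.1 * x.1))).trace ∈ E := by
        have := sub_mem (hG _ (mul_mem hg (mul_mem hx (mul_mem hx hy))))
          (hG _ (mul_mem hg (mul_mem hx (mul_mem hy hx))))
        simpa [mul_sub, Matrix.trace_sub] using this
      rw [Matrix.SpecialLinearGroup.coe_mul, e1, ← ht] at m1
      rw [e0, ← ht] at m0
      rw [e2, ← hκ, ← ht] at m2
      rw [e3, ← hκ, ← ht] at m3
      have hts : (t : ℝ) ^ 2 - 4 ≠ 0 := by rwa [ht, sub_ne_zero]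
      have hκs : (κ : ℝ) ≠ 0 := by exact_mod_cast hκ0
      have n1 : p₁ ∈ E := by
        have : p₁ = (2 * (t * p₀ + (t ^ 2 - 2) * p₁) - t * (2 * p₀ + t * p₁)) /
            ((t : ℝ) ^ 2 - 4) := by
          field_simp
          ring
        rw [this]
        exact div_mem (sub_mem (mul_mem (ofNat_mem E 2) m1) (mul_mem t.2 m0))
          (sub_mem (pow_mem t.2 2) (ofNat_mem E 4))
      have n0 : p₀ ∈ E := by
        have : p₀ = ((2 * p₀ + t * p₁) - t * p₁) / 2 := by ring
        rw [this]
        exact div_mem (sub_mem m0 (mul_mem t.2 n1)) (ofNat_mem E 2)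
      have n3 : p₃ ∈ E := by
        have : p₃ = (t * (κ * (2 * p₂ + t * p₃)) - 2 * (κ * (t * p₂ + 2 * p₃))) /
            (κ * ((t : ℝ) ^ 2 - 4)) := by
          field_simp
          ring
        rw [this]
        exact div_mem (sub_mem (mul_mem t.2 m2) (mul_mem (ofNat_mem E 2) m3))
          (mul_mem κ.2 (sub_mem (pow_mem t.2 2) (ofNat_mem E 4)))
      have n2 : p₂ ∈ E := by
        have : p₂ = (κ * (2 * p₂ + t * p₃) / κ - t * p₃) / 2 := by
          field_simp
          ring
        rw [this]
        exact div_mem (sub_mem (div_mem m2 κ.2) (mul_mem t.2 n3)) (ofNat_mem E 2)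
      exact ⟨⟨⟨p₀, n0⟩, ⟨p₁, n1⟩, ⟨p₂, n2⟩, ⟨p₃, n3⟩⟩, (hq _).trans hp.symm⟩
  exact ⟨((AlgEquiv.ofInjective q.liftHom hinj).trans (Subalgebra.equivOfEq _ _ hrange)).symm⟩

/-! ### Conjugates of 2cos(π/m) -/

section Cosines

open Polynomial

/-- The field `ℚ(2 cos (π / m))`. -/
abbrev cosField (m : ℕ) : IntermediateField ℚ ℝ :=
  IntermediateField.adjoin ℚ {2 * Real.cos (Real.pi / m)}

/-- `2 cos (k π / s)`. -/
def lam (k s : ℕ) : ℝ := 2 * Real.cos (k * Real.pi / s)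

/-- The polynomial does not depend on k, so an embedding is known on every λ_s with s ∣ m once it is
known on λ_m. -/
theorem aeval_chebyshev_lam {m s : ℕ} (hm : 0 < m) (hs : s ∣ m) (k : ℕ) :
    aeval (lam k m) (Chebyshev.C ℚ ((m / s : ℕ) : ℤ)) = lam k s := by
  obtain ⟨d, rfl⟩ := hs
  have hs0 : s ≠ 0 := by rintro rfl; simp at hm
  have hd0 : d ≠ 0 := by rintro rfl; simp at hm
  rw [Nat.mul_div_cancel_left _ (Nat.pos_of_ne_zero hs0), lam, lam, Chebyshev.aeval_C,
    Chebyshev.C_two_mul_real_cos]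
  congr 2
  push_cast
  field_simp

theorem lam_one_mem_cosField {m s : ℕ} (hm : 0 < m) (hs : s ∣ m) : lam 1 s ∈ cosField m := by
  rw [← aeval_chebyshev_lam hm hs]
  have h : lam 1 m ∈ cosField m := by
    simpa [lam] using IntermediateField.mem_adjoin_simple_self ℚ (2 * Real.cos (Real.pi / m))
  exact Algebra.adjoin_le (S := (cosField m).toSubalgebra) (Set.singleton_subset_iff.2 h)
    (aeval_mem_adjoin_singleton ℚ _)

/-- The exponent 2m - 1 stands for inversion, which makes 2cos(kπ/m) the value at ζ^k of one
polynomial independent of k. -/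
theorem exp_pow_add_exp_pow {m : ℕ} (hm : 0 < m) (k : ℕ) :
    (Complex.exp (2 * Real.pi * Complex.I / (2 * m : ℕ)) ^ k) +
      (Complex.exp (2 * Real.pi * Complex.I / (2 * m : ℕ)) ^ k) ^ (2 * m - 1) = (lam k m : ℂ) := by
  have hζ := Complex.isPrimitiveRoot_exp (2 * m) (by omega)
  set ζ := Complex.exp (2 * Real.pi * Complex.I / (2 * m : ℕ)) with hζ'
  have h1 : (ζ ^ k) ^ (2 * m - 1) = (ζ ^ k)⁻¹ := by
    apply eq_inv_of_mul_eq_one_left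
    rw [← pow_succ, Nat.sub_add_cancel (by omega), ← pow_mul, mul_comm,
      pow_mul, hζ.pow_eq_one, one_pow]
  have hm0 : (m : ℂ) ≠ 0 := by exact_mod_cast hm.ne'
  have h2 : ζ ^ k = Complex.exp ((k * Real.pi / m : ℝ) * Complex.I) := by
    rw [hζ', ← Complex.exp_nat_mul]
    congr 1
    push_cast
    field_simp
  rw [h1, h2, ← Complex.exp_neg, lam]
  push_cast
  rw [Complex.cos]
  ring_nf

/-- Irreducibility of the cyclotomic polynomial: ζ and ζ^k have the same minimal polynomial, and it
divides the pullback of P along X + X^(2m-1). -/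
theorem aeval_minpoly_lam {m k : ℕ} (hm : 0 < m) (hk : k.Coprime (2 * m)) :
    aeval (lam k m) (minpoly ℚ (lam 1 m)) = 0 := by
  have hζ := Complex.isPrimitiveRoot_exp (2 * m) (by omega)
  have hsum := exp_pow_add_exp_pow hm
  set ζ := Complex.exp (2 * Real.pi * Complex.I / (2 * m : ℕ))
  set P := minpoly ℚ (lam 1 m)
  have key : ∀ l : ℕ, aeval (ζ ^ l) (P.comp (X + X ^ (2 * m - 1))) =
      ((aeval (lam l m) P : ℝ) : ℂ) := by
    intro l
    rw [aeval_comp]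
    simp only [map_add, map_pow, aeval_X]
    rw [hsum l]
    exact aeval_algebraMap_apply ℂ (lam l m) P
  have h1 : aeval ζ (P.comp (X + X ^ (2 * m - 1))) = 0 := by
    have := key 1
    rwa [minpoly.aeval, pow_one, Complex.ofReal_zero] at this
  have hmin : minpoly ℚ ζ = minpoly ℚ (ζ ^ k) := by
    rw [← cyclotomic_eq_minpoly_rat hζ (by omega),
      ← cyclotomic_eq_minpoly_rat (hζ.pow_of_coprime k hk) (by omega)]
  have h2 : aeval (ζ ^ k) (P.comp (X + X ^ (2 * m - 1))) = 0 := by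
    obtain ⟨Q, hQ⟩ := minpoly.dvd ℚ ζ h1
    rw [hQ, hmin, map_mul, minpoly.aeval, zero_mul]
  rw [key k] at h2
  exact_mod_cast h2

theorem isIntegral_lam {m : ℕ} (hm : 0 < m) : IsIntegral ℚ (lam 1 m) := by
  have hζ := Complex.isPrimitiveRoot_exp (2 * m) (by omega)
  have hint : IsIntegral ℚ (Complex.exp (2 * Real.pi * Complex.I / (2 * m : ℕ))) :=
    (hζ.isIntegral (by omega)).tower_top
  have : IsIntegral ℚ ((lam 1 m : ℝ) : ℂ) := by
    rw [← exp_pow_add_exp_pow hm]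
    exact (hint.pow 1).add ((hint.pow 1).pow _)
  exact (isIntegral_algHom_iff (Complex.ofRealAm.restrictScalars ℚ)
    Complex.ofReal_injective).1 this

theorem exists_cosField_embedding {m k : ℕ} (hm : 0 < m) (hk : k.Coprime (2 * m)) :
    ∃ φ : cosField m →ₐ[ℚ] ℝ, ∀ s, s ∣ m → ∀ z : cosField m, (z : ℝ) = lam 1 s →
      φ z = lam k s := by
  have hgen : lam 1 m = 2 * Real.cos (Real.pi / m) := by simp [lam]
  have hint := isIntegral_lam hm
  have hroot := aeval_minpoly_lam hm hk
  rw [hgen] at hint hroot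
  let pb := IntermediateField.adjoin.powerBasis hint
  have hpb : pb.gen = IntermediateField.AdjoinSimple.gen ℚ (2 * Real.cos (Real.pi / m)) :=
    IntermediateField.adjoin.powerBasis_gen hint
  have hmin : aeval (lam k m) (minpoly ℚ pb.gen) = 0 := by
    have : minpoly ℚ pb.gen = minpoly ℚ (2 * Real.cos (Real.pi / m)) := by
      rw [hpb]
      exact IntermediateField.minpoly_gen ℚ _
    rwa [this]
  refine ⟨pb.lift (lam k m) hmin, fun s hs z hz => ?_⟩
  have hz' : z = aeval pb.gen (Chebyshev.C ℚ ((m / s : ℕ) : ℤ)) := by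
    apply Subtype.ext
    have h1 := aeval_algebraMap_apply ℝ pb.gen (Chebyshev.C ℚ ((m / s : ℕ) : ℤ))
    have h2 : algebraMap (cosField m) ℝ pb.gen = lam 1 m := by
      rw [hpb, hgen]
      rfl
    erw [h2] at h1
    rw [aeval_chebyshev_lam hm hs] at h1
    rw [hz]
    exact h1
  rw [hz']
  erw [pb.lift_aeval]
  exact aeval_chebyshev_lam hm hs k

end Cosines

/-! ### Trace fields of two-generator groups -/

section Traces

/-- Polarised Cayley–Hamilton; it rewrites yx through 1, x, y, xy. -/
theorem mul_swap_of_traces {R : Type*} [CommRing R] {x y : Matrix (Fin 2) (Fin 2) R} :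
    y * x = x.trace • y + y.trace • x + ((x * y).trace - x.trace * y.trace) • 1 - x * y := by
  ext i j
  fin_cases i <;> fin_cases j <;>
    simp [Matrix.mul_apply, Fin.sum_univ_two, Matrix.trace_fin_two] <;> ring

/-- `(tr M, tr (M x), tr (M y), tr (M x y))` all lie in `F`. -/
def TracesIn (F : IntermediateField ℚ ℝ) (x y M : Matrix (Fin 2) (Fin 2) ℝ) : Prop :=
  M.trace ∈ F ∧ (M * x).trace ∈ F ∧ (M * y).trace ∈ F ∧ (M * (x * y)).trace ∈ F

variable {F : IntermediateField ℚ ℝ} {x y M N : Matrix (Fin 2) (Fin 2) ℝ}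

theorem TracesIn.neg (h : TracesIn F x y M) : TracesIn F x y (-M) := by
  obtain ⟨h1, h2, h3, h4⟩ := h
  refine ⟨?_, ?_, ?_, ?_⟩ <;> simpa

theorem TracesIn.sub (h : TracesIn F x y M) (h' : TracesIn F x y N) :
    TracesIn F x y (M - N) := by
  obtain ⟨h1, h2, h3, h4⟩ := h
  obtain ⟨h1', h2', h3', h4'⟩ := h'
  refine ⟨?_, ?_, ?_, ?_⟩ <;> simp only [sub_mul, Matrix.trace_sub] <;>
    apply sub_mem <;> assumption

theorem TracesIn.smul {u : ℝ} (hu : u ∈ F) (h : TracesIn F x y M) :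
    TracesIn F x y (u • M) := by
  obtain ⟨h1, h2, h3, h4⟩ := h
  refine ⟨?_, ?_, ?_, ?_⟩ <;>
    simp only [smul_mul_assoc, Matrix.trace_smul, smul_eq_mul] <;>
    apply mul_mem <;> assumption

theorem TracesIn.mul_fst (hx : x.det = 1) (hxF : x.trace ∈ F) (h : TracesIn F x y M) :
    TracesIn F x y (M * x) := by
  obtain ⟨h1, h2, h3, h4⟩ := h
  have hxx := mul_self_of_det_eq_one hx
  refine ⟨h2, ?_, ?_, ?_⟩
  · rw [mul_assoc, hxx]
    simpa [mul_add] using add_mem (neg_mem h1) (mul_mem hxF h2)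
  · rwa [mul_assoc]
  · rw [mul_assoc, ← mul_assoc x, hxx]
    simpa [mul_add, add_mul] using add_mem (neg_mem h3) (mul_mem hxF h4)

theorem TracesIn.mul_snd (hy : y.det = 1) (hxF : x.trace ∈ F) (hyF : y.trace ∈ F)
    (hxyF : (x * y).trace ∈ F) (h : TracesIn F x y M) : TracesIn F x y (M * y) := by
  obtain ⟨h1, h2, h3, h4⟩ := h
  have hyy := mul_self_of_det_eq_one hy
  have hyx := mul_swap_of_traces (x := x) (y := y)
  have hyyF : (M * (y * y)).trace ∈ F := by
    rw [hyy]
    simpa [mul_add] using add_mem (neg_mem h1) (mul_mem hyF h3)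
  have hxyyF : (M * (x * (y * y))).trace ∈ F := by
    rw [hyy]
    simpa [mul_add] using add_mem (neg_mem h2) (mul_mem hyF h4)
  have hc := sub_mem hxyF (mul_mem hxF hyF)
  refine ⟨h3, ?_, ?_, ?_⟩
  · rw [mul_assoc, hyx]
    simpa [mul_add, mul_sub] using
      sub_mem (add_mem (add_mem (mul_mem hxF h3) (mul_mem hyF h2)) (mul_mem hc h1)) h4
  · rwa [mul_assoc]
  · rw [mul_assoc, ← mul_assoc y, hyx]
    simpa [mul_add, add_mul, mul_sub, sub_mul, mul_assoc] using
      sub_mem (add_mem (add_mem (mul_mem hxF hyyF) (mul_mem hyF h4)) (mul_mem hc h3)) hxyyF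

theorem coe_inv_eq_trace_smul_sub (g : SL(2, ℝ)) :
    ((g⁻¹ : SL(2, ℝ)) : Matrix (Fin 2) (Fin 2) ℝ) = g.1.trace • 1 - g.1 := by
  rw [Matrix.SpecialLinearGroup.coe_inv]
  ext i j
  fin_cases i <;> fin_cases j <;> simp [Matrix.adjugate_fin_two, Matrix.trace_fin_two]

/-- A field containing the traces of `x`, `y`, `x * y` contains the traces of the group generated
by `-1`, `x`, `y`, and `-(x * y)⁻¹`. -/
theorem trace_mem_of_mem_closure {F : IntermediateField ℚ ℝ} {x y : SL(2, ℝ)}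
    (hxF : x.1.trace ∈ F) (hyF : y.1.trace ∈ F) (hxyF : (x.1 * y.1).trace ∈ F) {g : SL(2, ℝ)}
    (hg : g ∈ Subgroup.closure {-1, x, y, -(x * y)⁻¹}) : g.1.trace ∈ F := by
  have mx : ∀ h : SL(2, ℝ), TracesIn F x.1 y.1 h.1 → TracesIn F x.1 y.1 (h * x).1 :=
    fun h hh => hh.mul_fst x.2 hxF
  have my : ∀ h : SL(2, ℝ), TracesIn F x.1 y.1 h.1 → TracesIn F x.1 y.1 (h * y).1 :=
    fun h hh => hh.mul_snd y.2 hxF hyF hxyF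
  have mx' : ∀ h : SL(2, ℝ), TracesIn F x.1 y.1 h.1 → TracesIn F x.1 y.1 (h * x⁻¹).1 := by
    intro h hh
    rw [Matrix.SpecialLinearGroup.coe_mul, coe_inv_eq_trace_smul_sub, mul_sub, mul_smul_comm,
      mul_one]
    exact (hh.smul hxF).sub (mx h hh)
  have my' : ∀ h : SL(2, ℝ), TracesIn F x.1 y.1 h.1 → TracesIn F x.1 y.1 (h * y⁻¹).1 := by
    intro h hh
    rw [Matrix.SpecialLinearGroup.coe_mul, coe_inv_eq_trace_smul_sub, mul_sub, mul_smul_comm,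
      mul_one]
    exact (hh.smul hyF).sub (my h hh)
  have mn : ∀ h : SL(2, ℝ), TracesIn F x.1 y.1 h.1 → TracesIn F x.1 y.1 (-h).1 := by
    intro h hh
    rw [Matrix.SpecialLinearGroup.coe_neg]
    exact hh.neg
  -- The trace alone does not survive induction on words; the four traces against 1, x, y, xy do.
  suffices H : TracesIn F x.1 y.1 g.1 from H.1
  induction hg using Subgroup.closure_induction_right with
  | one =>
    refine ⟨?_, ?_, ?_, ?_⟩
    · simp
    · simpa using hxF
    · simpa using hyF
    · simpa using hxyF
  | mul_right h _ z hz hh =>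
    rcases hz with rfl | rfl | rfl | rfl
    · simpa using mn h hh
    · exact mx h hh
    · exact my h hh
    · have := mn _ (mx' _ (my' _ hh))
      rwa [mul_assoc, ← mul_inv_rev, ← mul_neg] at this
  | mul_inv_cancel h _ z hz hh =>
    rcases hz with rfl | rfl | rfl | rfl
    · simpa using mn h hh
    · exact mx' h hh
    · exact my' h hh
    · have := mn _ (my _ (mx _ hh))
      rwa [mul_assoc, ← mul_neg, ← inv_inv (-(x * y)), inv_neg] at this

/-- By Cayley–Hamilton x² and y² differ from tr(x)x and tr(y)y by scalars, so [x², y²] =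
tr(x)tr(y)[x, y]; then square. -/
theorem commForm_sq_sq {x y : Matrix (Fin 2) (Fin 2) ℝ} (hx : x.det = 1) (hy : y.det = 1) :
    commForm (x * x).trace (y * y).trace (x * x * (y * y)).trace =
      x.trace ^ 2 * y.trace ^ 2 * commForm x.trace y.trace (x * y).trace := by
  have h : x * x * (y * y) - y * y * (x * x) = (x.trace * y.trace) • (x * y - y * x) := by
    rw [mul_self_of_det_eq_one hx, mul_self_of_det_eq_one hy]
    simp only [add_mul, mul_add, smul_mul_assoc, mul_smul_comm, one_mul, mul_one]
    module
  have h1 := commutator_mul_self (x := x * x) (y := y * y) (by simp [hx]) (by simp [hy])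
  rw [h, smul_mul_smul_comm, commutator_mul_self hx hy] at h1
  have h2 := congrFun (congrFun h1 0) 0
  simp at h2
  linear_combination -h2

end Traces

/-! ### The triangle group, its trace field and its split places -/

section Generators

variable {a b c : ℕ}

theorem trace_deltaA (a : ℕ) : (deltaA a).1.trace = lam 1 a := by
  simp [deltaA, rot, lam, Matrix.trace_fin_two]
  ring

theorem coe_deltaB (a b c : ℕ) : (deltaB a b c).1 =
    !![Real.cos (Real.pi / b), Real.exp (sideLength a b c) * Real.sin (Real.pi / b);
      -(Real.exp (-sideLength a b c) * Real.sin (Real.pi / b)), Real.cos (Real.pi / b)] := by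
  have h : Real.exp (sideLength a b c / 2) * Real.exp (-(sideLength a b c / 2)) = 1 := by
    rw [← Real.exp_add]; simp
  have h1 : Real.exp (sideLength a b c) =
      Real.exp (sideLength a b c / 2) * Real.exp (sideLength a b c / 2) := by
    rw [← Real.exp_add]; ring_nf
  have h2 : Real.exp (-sideLength a b c) =
      Real.exp (-(sideLength a b c / 2)) * Real.exp (-(sideLength a b c / 2)) := by
    rw [← Real.exp_add]; ring_nf
  rw [deltaB, h1, h2]
  generalize sideLength a b c = d at *
  rw [Matrix.SpecialLinearGroup.coe_mul, Matrix.SpecialLinearGroup.coe_mul,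
    Matrix.SpecialLinearGroup.coe_inv, Matrix.adjugate_fin_two]
  simp only [transl, rot]
  ext i j
  fin_cases i <;> fin_cases j <;> simp [Matrix.mul_apply, Fin.sum_univ_two]
  · linear_combination Real.cos (Real.pi / b) * h
  · ring
  · ring
  · linear_combination Real.cos (Real.pi / b) * h

theorem trace_deltaB (a b c : ℕ) : (deltaB a b c).1.trace = lam 1 b := by
  rw [coe_deltaB]
  simp [lam, Matrix.trace_fin_two]
  ring

/-- The point is that the argument of `arcosh` is at least 1, which holds because the angle sum is
less than π. -/
theorem cosh_sideLength (ha : 2 ≤ a) (hb : 2 ≤ b) (hyp : chi a b c < 0) :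
    Real.cosh (sideLength a b c) * (Real.sin (Real.pi / a) * Real.sin (Real.pi / b)) =
      Real.cos (Real.pi / a) * Real.cos (Real.pi / b) + Real.cos (Real.pi / c) := by
  have hπ := Real.pi_pos
  have hsin : ∀ s : ℕ, 2 ≤ s → 0 < Real.sin (Real.pi / s) := by
    intro s hs
    have : (2 : ℝ) ≤ s := by exact_mod_cast hs
    apply Real.sin_pos_of_pos_of_lt_pi (by positivity)
    rw [div_lt_iff₀ (by linarith)]
    nlinarith
  have hs := mul_pos (hsin a ha) (hsin b hb)
  have hsum : Real.pi / a + Real.pi / b ≤ Real.pi - Real.pi / c := by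
    have : Real.pi / a + Real.pi / b + Real.pi / c = Real.pi * (chi a b c + 1) := by
      rw [chi]; ring
    nlinarith
  have h1 : Real.cos (Real.pi - Real.pi / c) ≤ Real.cos (Real.pi / a + Real.pi / b) :=
    Real.cos_le_cos_of_nonneg_of_le_pi (by positivity)
      (by linarith [show 0 ≤ Real.pi / c by positivity]) hsum
  rw [Real.cos_pi_sub, Real.cos_add] at h1
  rw [sideLength, Real.cosh_arcosh, div_mul_cancel₀ _ hs.ne']
  rw [one_le_div hs]
  linarith

theorem trace_deltaA_mul_deltaB (ha : 2 ≤ a) (hb : 2 ≤ b) (hyp : chi a b c < 0) :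
    ((deltaA a).1 * (deltaB a b c).1).trace = -lam 1 c := by
  have h := cosh_sideLength ha hb hyp
  rw [Real.cosh_eq] at h
  rw [coe_deltaB]
  simp [deltaA, rot, lam, Matrix.trace_fin_two]
  linear_combination (-2) * h

theorem trace_deltaC (ha : 2 ≤ a) (hb : 2 ≤ b) (hyp : chi a b c < 0) :
    (deltaC a b c).1.trace = lam 1 c := by
  have h := trace_deltaA_mul_deltaB ha hb hyp
  rw [deltaC, Matrix.SpecialLinearGroup.coe_neg, coe_inv_eq_trace_smul_sub,
    Matrix.SpecialLinearGroup.coe_mul, h]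
  simp [h]
  ring

theorem trace_deltaB_mul_deltaC (a b c : ℕ) :
    ((deltaB a b c).1 * (deltaC a b c).1).trace = -lam 1 a := by
  have h : deltaB a b c * deltaC a b c = -(deltaA a)⁻¹ := by
    rw [deltaC, mul_inv_rev, mul_neg, mul_inv_cancel_left]
  rw [← Matrix.SpecialLinearGroup.coe_mul, h, Matrix.SpecialLinearGroup.coe_neg,
    coe_inv_eq_trace_smul_sub, trace_deltaA]
  simp [trace_deltaA]
  ring

theorem deltaB_mem (a b c : ℕ) : deltaB a b c ∈ Delta a b c :=
  Subgroup.subset_closure (by simp)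

theorem deltaC_mem (a b c : ℕ) : deltaC a b c ∈ Delta a b c :=
  Subgroup.subset_closure (by simp)

theorem mul_self_mem_Delta2 {g : SL(2, ℝ)} (hg : g ∈ Delta a b c) : g * g ∈ Delta2 a b c :=
  Subgroup.subset_closure (Or.inr ⟨g, hg, (sq g).symm⟩)

theorem Delta2_le_Delta (a b c : ℕ) : Delta2 a b c ≤ Delta a b c := by
  rw [Delta2, Subgroup.closure_le]
  rintro g (rfl | ⟨h, hh, rfl⟩)
  · exact Subgroup.subset_closure (by simp)
  · exact pow_mem hh 2

theorem trace_mul_self_of_det_eq_one {x : Matrix (Fin 2) (Fin 2) ℝ} (hx : x.det = 1) :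
    (x * x).trace = x.trace ^ 2 - 2 := by
  rw [mul_self_of_det_eq_one hx]
  simp
  ring

theorem trace_mem_invariantTraceField {g : SL(2, ℝ)} (hg : g ∈ Delta2 a b c) :
    g.1.trace ∈ invariantTraceField a b c :=
  IntermediateField.subset_adjoin _ _ ⟨g, hg, rfl⟩

/-- Even the traces of all of Δ lie in ℚ(2cos(π/m)), so embeddings of that field restrict to E. -/
theorem invariantTraceField_le {m : ℕ} (hm : 0 < m) (ham : a ∣ m) (hbm : b ∣ m) (hcm : c ∣ m)
    (ha : 2 ≤ a) (hb : 2 ≤ b) (hyp : chi a b c < 0) :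
    invariantTraceField a b c ≤ cosField m := by
  rw [invariantTraceField, IntermediateField.adjoin_le_iff]
  rintro _ ⟨g, hg, rfl⟩
  apply trace_mem_of_mem_closure (x := deltaA a) (y := deltaB a b c) _ _ _
    (Delta2_le_Delta a b c hg)
  · rw [trace_deltaA]
    exact lam_one_mem_cosField hm ham
  · rw [trace_deltaB]
    exact lam_one_mem_cosField hm hbm
  · rw [trace_deltaA_mul_deltaB ha hb hyp]
    exact neg_mem (lam_one_mem_cosField hm hcm)

/-- `λ_a² + λ_b² + λ_c² + λ_a λ_b λ_c - 4`, where `λ_s = 2 cos (k π / s)`. -/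
def kappa (k a b c : ℕ) : ℝ :=
  lam k a ^ 2 + lam k b ^ 2 + lam k c ^ 2 + lam k a * lam k b * lam k c - 4

theorem lam_one_pos {s : ℕ} (hs : 3 ≤ s) : 0 < lam 1 s := by
  have hπ := Real.pi_pos
  have hs' : (3 : ℝ) ≤ s := by exact_mod_cast hs
  have : Real.pi / s < Real.pi / 2 := by
    apply div_lt_div_of_pos_left hπ <;> linarith
  rw [lam, Nat.cast_one, one_mul]
  have := Real.cos_pos_of_mem_Ioo ⟨by linarith [show 0 < Real.pi / s by positivity], this⟩
  linarith

theorem lam_one_lt_two {s : ℕ} (hs : 3 ≤ s) : lam 1 s < 2 := by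
  have hπ := Real.pi_pos
  have hs' : (3 : ℝ) ≤ s := by exact_mod_cast hs
  have : Real.pi / s ≤ Real.pi := by
    apply div_le_self <;> linarith
  rw [lam, Nat.cast_one, one_mul]
  have := Real.cos_lt_cos_of_nonneg_of_le_pi le_rfl this (by positivity)
  rw [Real.cos_zero] at this
  linarith

/-- The Galois conjugate indexed by `k` of the identity embedding of the invariant trace field
is a split place as soon as the conjugate of `kappa` is nonnegative. -/
theorem exists_isSplitAt {m k : ℕ} (hm : 0 < m) (ham : a ∣ m) (hbm : b ∣ m) (hcm : c ∣ m)
    (hk : k.Coprime (2 * m)) (ha : 2 ≤ a) (hb : 3 ≤ b) (hc : 3 ≤ c) (hyp : chi a b c < 0)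
    (h1 : 0 < kappa 1 a b c) (hκ : 0 ≤ kappa k a b c) :
    ∃ σ : invariantTraceField a b c →+* ℝ, IsSplitAt (quaternionAlg a b c) σ ∧
      ∀ z : invariantTraceField a b c, (z : ℝ) = lam 1 c ^ 2 - 2 → σ z = lam k c ^ 2 - 2 := by
  obtain ⟨φ, hφ⟩ := exists_cosField_embedding hm hk
  have hle := invariantTraceField_le hm ham hbm hcm ha (by omega) hyp
  let ι := IntermediateField.inclusion hle
  let σ : invariantTraceField a b c →+* ℝ := (φ.comp ι).toRingHom
  let A : cosField m := ⟨lam 1 a, lam_one_mem_cosField hm ham⟩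
  let B : cosField m := ⟨lam 1 b, lam_one_mem_cosField hm hbm⟩
  let C : cosField m := ⟨lam 1 c, lam_one_mem_cosField hm hcm⟩
  have hA : φ A = lam k a := hφ a ham A rfl
  have hB : φ B = lam k b := hφ b hbm B rfl
  have hC : φ C = lam k c := hφ c hcm C rfl
  have hσ : ∀ (z : invariantTraceField a b c) (w : cosField m), (z : ℝ) = w → σ z = φ w := by
    intro z w hzw
    change φ (ι z) = φ w
    congr 1
    exact Subtype.ext hzw
  -- The pair δ_b, δ_c is used because b, c ≥ 3 makes λ_b and λ_c nonzero, whereas λ_a = 0 when a =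
  -- 2.
  set x := deltaB a b c * deltaB a b c with hx
  set y := deltaC a b c * deltaC a b c with hy
  have hxG : x ∈ Delta2 a b c := mul_self_mem_Delta2 (deltaB_mem a b c)
  have hyG : y ∈ Delta2 a b c := mul_self_mem_Delta2 (deltaC_mem a b c)
  have hxE := trace_mem_invariantTraceField hxG
  have hyE := trace_mem_invariantTraceField hyG
  have hxyE := trace_mem_invariantTraceField (mul_mem hxG hyG)
  have hκval : commForm x.1.trace y.1.trace (x.1 * y.1).trace =
      lam 1 b ^ 2 * lam 1 c ^ 2 * kappa 1 a b c := by
    rw [hx, hy, Matrix.SpecialLinearGroup.coe_mul, Matrix.SpecialLinearGroup.coe_mul,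
      commForm_sq_sq (deltaB a b c).2 (deltaC a b c).2, trace_deltaB,
      trace_deltaC ha (by omega) hyp, trace_deltaB_mul_deltaC, commForm, kappa]
    ring
  let t : invariantTraceField a b c := ⟨x.1.trace, hxE⟩
  let κ : invariantTraceField a b c :=
    commForm t ⟨y.1.trace, hyE⟩ ⟨(x.1 * y.1).trace, hxyE⟩
  have hκE : (κ : ℝ) = commForm x.1.trace y.1.trace (x.1 * y.1).trace := by
    simp only [κ, t, commForm]
    rfl
  have htE : (t : ℝ) = lam 1 b ^ 2 - 2 := by
    change x.1.trace = _
    rw [hx, Matrix.SpecialLinearGroup.coe_mul, trace_mul_self_of_det_eq_one (deltaB a b c).2,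
      trace_deltaB]
  have hbpos := lam_one_pos hb
  have hcpos := lam_one_pos hc
  have hκpos : (κ : ℝ) ≠ 0 := by
    rw [hκE, hκval]
    positivity
  have hκ0 : κ ≠ 0 := fun h => hκpos (by rw [h]; rfl)
  have ht4 : t ^ 2 ≠ 4 := by
    intro h
    have h' : (t : ℝ) ^ 2 = 4 := congrArg Subtype.val h
    rw [htE] at h'
    have hlt := lam_one_lt_two hb
    have h2 : lam 1 b ^ 2 * (4 - lam 1 b ^ 2) = 0 := by linear_combination -h'
    have : 0 < lam 1 b ^ 2 * (4 - lam 1 b ^ 2) := mul_pos (by positivity) (by nlinarith)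
    linarith
  have hσκ : σ κ = lam k b ^ 2 * lam k c ^ 2 * kappa k a b c := by
    rw [hσ κ (B ^ 2 * C ^ 2 * (A ^ 2 + B ^ 2 + C ^ 2 + A * B * C - 4)) (by
      rw [hκE, hκval, kappa]; rfl)]
    simp only [map_mul, map_pow, map_add, map_sub, hA, hB, hC, map_ofNat, kappa]
  -- Nonnegativity suffices: κ ≠ 0 and σ is injective.
  have hσpos : 0 < σ κ := by
    apply lt_of_le_of_ne
    · rw [hσκ]
      positivity
    · exact fun h => hκ0 ((map_eq_zero σ).1 h.symm)
  obtain ⟨e⟩ := exists_algEquiv_adjoin (fun g hg => trace_mem_invariantTraceField hg) hxG hyG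
    (t := t) (κ := κ) rfl hκE ht4 hκ0
  refine ⟨σ, isSplitAt_of_algEquiv σ ht4 hσpos e, fun z hz => ?_⟩
  rw [hσ z (C ^ 2 - 2) (by rw [hz]; rfl), map_sub, map_pow, hC, map_ofNat]

/-- This is the trace of δ_c²; its images distinguish the embeddings of E. -/
theorem lam_sq_sub_two_mem (ha : 2 ≤ a) (hb : 2 ≤ b) (hyp : chi a b c < 0) :
    lam 1 c ^ 2 - 2 ∈ invariantTraceField a b c := by
  rw [← trace_deltaC ha hb hyp, ← trace_mul_self_of_det_eq_one (deltaC a b c).2]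
  exact trace_mem_invariantTraceField (mul_self_mem_Delta2 (deltaC_mem a b c))

end Generators

/-! ### Signs of the conjugates of `kappa` -/

section Kappa

variable {a b c k : ℕ}

theorem kappa_eq_mul (k a b c : ℕ) : kappa k a b c =
    4 * (Real.cos (k * Real.pi / a) + Real.cos (k * Real.pi / b + k * Real.pi / c)) *
      (Real.cos (k * Real.pi / a) + Real.cos (k * Real.pi / b - k * Real.pi / c)) := by
  rw [kappa, lam, lam, lam, Real.cos_add, Real.cos_sub]
  have hb := Real.sin_sq_add_cos_sq (k * Real.pi / b)
  have hc := Real.sin_sq_add_cos_sq (k * Real.pi / c)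
  linear_combination 4 * Real.sin (k * Real.pi / c) ^ 2 * hb
    + (4 - 4 * Real.cos (k * Real.pi / b) ^ 2) * hc

theorem kappa_rotate (k a b c : ℕ) : kappa k a b c = kappa k c a b := by
  rw [kappa, kappa]
  ring

theorem cos_add_le_cos_sub {x y : ℝ} (hx : 0 ≤ x) (hy : 0 ≤ y) (h : x + y ≤ Real.pi) :
    Real.cos (x + y) ≤ Real.cos (x - y) := by
  rw [← Real.cos_abs (x - y)]
  refine Real.cos_le_cos_of_nonneg_of_le_pi (abs_nonneg _) h ?_
  rw [abs_le]
  constructor <;> linarith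

/-- When the two angles sum to at most π, the second factor of `kappa_eq_mul` dominates the first,
so only the first needs checking. -/
theorem kappa_nonneg_of_cos (h : k * Real.pi / b + k * Real.pi / c ≤ Real.pi)
    (hcos : 0 ≤ Real.cos (k * Real.pi / a) + Real.cos (k * Real.pi / b + k * Real.pi / c)) :
    0 ≤ kappa k a b c := by
  have hπ := Real.pi_pos
  have := cos_add_le_cos_sub (x := k * Real.pi / b) (y := k * Real.pi / c)
    (by positivity) (by positivity) h
  rw [kappa_eq_mul]
  apply mul_nonneg <;> linarith

theorem kappa_one_pos (hyp : chi a b c < 0) : 0 < kappa 1 a b c := by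
  have hπ := Real.pi_pos
  have hsum : Real.pi / b + Real.pi / c < Real.pi - Real.pi / a := by
    have : Real.pi / a + Real.pi / b + Real.pi / c = Real.pi * (chi a b c + 1) := by
      rw [chi]; ring
    nlinarith
  have ha0 : 0 ≤ Real.pi / a := by positivity
  have h1 : Real.cos (Real.pi - Real.pi / a) < Real.cos (Real.pi / b + Real.pi / c) :=
    Real.cos_lt_cos_of_nonneg_of_le_pi (by positivity) (by linarith) hsum
  have h2 := cos_add_le_cos_sub (x := Real.pi / b) (y := Real.pi / c)
    (by positivity) (by positivity) (by linarith)
  rw [Real.cos_pi_sub] at h1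
  rw [kappa_eq_mul]
  simp only [Nat.cast_one, one_mul]
  apply mul_pos <;> linarith

/-- Rational multiples of `π` with denominator `M` that are not odd multiples of `π` stay at
distance at least `π / M` from these. -/
theorem neg_cos_le_cos {M : ℕ} (hM : 0 < M) {N : ℤ} (hN : ∀ n : ℤ, N ≠ (2 * n + 1) * M) :
    -Real.cos (Real.pi / M) ≤ Real.cos (N * Real.pi / M) := by
  have hπ := Real.pi_pos
  have hM' : (0 : ℝ) < M := by exact_mod_cast hM
  have hMZ : (0 : ℤ) < M := by exact_mod_cast hM
  -- Shifting by π turns odd multiples of π into even ones; L is N + M reduced modulo 2M, and the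
  -- hypothesis says that L ≠ 0.
  obtain ⟨n, L, hL, h0, h1⟩ : ∃ n L : ℤ, N + M = L + n * (2 * M) ∧ 0 < L ∧ L < 2 * M := by
    refine ⟨(N + M) / (2 * M), (N + M) % (2 * M), ?_, ?_, Int.emod_lt_of_pos _ (by omega)⟩
    · linear_combination -Int.emod_add_mul_ediv (N + M) (2 * M)
    · refine lt_of_le_of_ne (Int.emod_nonneg _ (by omega)) fun h => ?_
      obtain ⟨d, hd⟩ := Int.dvd_of_emod_eq_zero h.symm
      exact hN (d - 1) (by linear_combination hd)
  have hcos : Real.cos (N * Real.pi / M) = -Real.cos (L * Real.pi / M) := by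
    have hN' : (N : ℝ) = L + n * (2 * M) - M := by
      have : ((N + M : ℤ) : ℝ) = ((L + n * (2 * M) : ℤ) : ℝ) := by rw [hL]
      push_cast at this
      linarith
    have : (N : ℝ) * Real.pi / M = L * Real.pi / M - Real.pi + n * (2 * Real.pi) := by
      rw [hN']
      field_simp
      ring
    rw [this, Real.cos_add_int_mul_two_pi, Real.cos_sub_pi]
  rw [hcos, neg_le_neg_iff]
  have key : ∀ K : ℤ, 0 < K → K ≤ M → Real.cos (K * Real.pi / M) ≤ Real.cos (Real.pi / M) := by
    intro K hK hKM
    have h1K : (1 : ℝ) ≤ K := by exact_mod_cast hK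
    have h2K : (K : ℝ) ≤ M := by exact_mod_cast hKM
    apply Real.cos_le_cos_of_nonneg_of_le_pi (by positivity)
    · rw [div_le_iff₀ hM']
      nlinarith
    · gcongr
      nlinarith
  rcases le_or_gt L M with h | h
  · exact key L h0 h
  · have := key (2 * M - L) (by omega) (by omega)
    have e : ((2 * M - L : ℤ) : ℝ) * Real.pi / M = 2 * Real.pi - L * Real.pi / M := by
      push_cast
      field_simp
    rwa [e, Real.cos_two_pi_sub] at this

/-- Since a does not divide k, cos(kπ/a) ≥ -cos(π/a), while the other two angles are small enough
that the cosine of their sum is at least cos(π/a). -/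
theorem kappa_nonneg_of_add_le (ha : 2 ≤ a) (hk : k.Coprime a)
    (h : k * Real.pi / b + k * Real.pi / c ≤ Real.pi / a) : 0 ≤ kappa k a b c := by
  have hπ := Real.pi_pos
  have ha' : (2 : ℝ) ≤ a := by exact_mod_cast ha
  have hpa : Real.pi / a ≤ Real.pi := div_le_self hπ.le (by linarith)
  have h1 := neg_cos_le_cos (M := a) (by omega) (N := k) (by
    intro n hn
    have : (a : ℤ) ∣ k := ⟨2 * n + 1, by linear_combination hn⟩
    have := Nat.Coprime.eq_one_of_dvd hk.symm (by exact_mod_cast this)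
    omega)
  have h2 := Real.cos_le_cos_of_nonneg_of_le_pi (x := k * Real.pi / b + k * Real.pi / c)
    (by positivity) hpa h
  apply kappa_nonneg_of_cos (by linarith)
  rw [Int.cast_natCast] at h1
  linarith

/-- Isolate the angle at c. The angles kπ/a ± kπ/b are multiples of π/(ab) and not odd multiples of
π: ab divides neither a + b nor a - b, except when a = b, where the difference is 0. So their
cosines are at least -cos(π/(ab)). -/
theorem kappa_nonneg_of_le (ha : 2 ≤ a) (hb : 3 ≤ b) (hk : k.Coprime (a * b))
    (h : k * Real.pi / c ≤ Real.pi / (a * b)) : 0 ≤ kappa k a b c := by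
  have hπ := Real.pi_pos
  have ha' : (2 : ℝ) ≤ a := by exact_mod_cast ha
  have hb' : (3 : ℝ) ≤ b := by exact_mod_cast hb
  have hab : 0 < a * b := by positivity
  have hpab : Real.pi / (a * b) ≤ Real.pi := div_le_self hπ.le (by nlinarith)
  have hkZ : IsCoprime ((a * b : ℕ) : ℤ) (k : ℤ) := Nat.isCoprime_iff_coprime.2 hk.symm
  have hlt : (a : ℤ) + b < a * b := by
    have ha2 : (2 : ℤ) ≤ a := by exact_mod_cast ha
    have hb3 : (3 : ℤ) ≤ b := by exact_mod_cast hb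
    nlinarith
  have h1 := neg_cos_le_cos (M := a * b) hab (N := k * (a + b)) (by
    intro n hn
    have hd : ((a * b : ℕ) : ℤ) ∣ a + b :=
      hkZ.dvd_of_dvd_mul_left ⟨2 * n + 1, by linear_combination hn⟩
    have := Int.le_of_dvd (by omega) hd
    push_cast at this
    omega)
  have h2 := neg_cos_le_cos (M := a * b) hab (N := k * (a - b)) (by
    intro n hn
    have hd : ((a * b : ℕ) : ℤ) ∣ a - b :=
      hkZ.dvd_of_dvd_mul_left ⟨2 * n + 1, by linear_combination hn⟩
    have h0 := Int.eq_zero_of_abs_lt_dvd hd (by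
      push_cast
      rw [abs_lt]
      constructor <;> omega)
    rw [h0, mul_zero, eq_comm, mul_eq_zero] at hn
    rcases hn with hn | hn <;> omega)
  have e1 : ((k * (a + b) : ℤ) : ℝ) * Real.pi / (a * b : ℕ) =
      k * Real.pi / a + k * Real.pi / b := by
    push_cast
    field_simp
    ring
  have e2 : ((k * (a - b) : ℤ) : ℝ) * Real.pi / (a * b : ℕ) =
      -(k * Real.pi / a - k * Real.pi / b) := by
    push_cast
    field_simp
    ring
  rw [e1] at h1
  rw [e2, Real.cos_neg] at h2
  have h3 := Real.cos_le_cos_of_nonneg_of_le_pi (x := k * Real.pi / c) (by positivity) hpab h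
  push_cast at h1 h2
  rw [kappa_rotate, kappa_eq_mul]
  apply mul_nonneg <;> linarith

/-- The bound 2q ≤ c keeps kπ/c in [0, π/2], where cosine is nonnegative and injective. -/
theorem lam_sq_injOn {q : ℕ} (hq : 0 < q) (hc : 2 * q ≤ c) :
    Set.InjOn (fun k => lam k c ^ 2 - 2) {k | k ≤ q} := by
  have hπ := Real.pi_pos
  have hc0 : (0 : ℝ) < c := by
    have : 0 < c := by omega
    exact_mod_cast this
  have hle : ∀ k, k ≤ q → k * Real.pi / c ≤ Real.pi / 2 := by
    intro k hk
    have : (2 : ℝ) * k ≤ c := by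
      have : 2 * k ≤ c := by omega
      exact_mod_cast this
    rw [div_le_div_iff₀ hc0 two_pos]
    nlinarith
  intro k hk l hl hkl
  have hpos : ∀ k, k ≤ q → 0 ≤ lam k c := fun k hk =>
    mul_nonneg two_pos.le (Real.cos_nonneg_of_neg_pi_div_two_le_of_le
      (by linarith [show 0 ≤ k * Real.pi / c by positivity]) (hle k hk))
  have h1 : lam k c = lam l c :=
    (sq_eq_sq₀ (hpos k hk) (hpos l hl)).1 (sub_left_injective hkl)
  have h2 := Real.injOn_cos ⟨by positivity, by linarith [hle k hk]⟩
    ⟨by positivity, by linarith [hle l hl]⟩ (mul_left_cancel₀ two_ne_zero h1)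
  field_simp at h2
  exact_mod_cast h2

end Kappa

/-! ### Counting split places -/

/-- There are not `r + 1` nonnegative conjugates of `kappa` among those indexed by `1` and the
first `r` nondividing primes. -/
theorem not_forall_kappa_nonneg {r a b c q : ℕ} (hr : 1 ≤ r) (ha : 2 ≤ a) (hb : 3 ≤ b)
    (hc : 3 ≤ c) (hyp : chi a b c < 0) (hdim : adim a b c = r)
    (hq : IsNondividingPrime (2 * Nat.lcm a (Nat.lcm b c)) r q) (hqc : 2 * q ≤ c)
    (H : ∀ k, k.Coprime a → k.Coprime b → k ≤ q → 0 ≤ kappa k a b c) : False := by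
  obtain ⟨hqp, hqn, hcard⟩ := hq
  set m := Nat.lcm a (Nat.lcm b c) with hm
  have hm0 : 0 < m := Nat.lcm_pos (by omega) (Nat.lcm_pos (by omega) (by omega))
  have ham : a ∣ m := Nat.dvd_lcm_left _ _
  have hbm : b ∣ m := (Nat.dvd_lcm_left _ _).trans (Nat.dvd_lcm_right _ _)
  have hcm : c ∣ m := (Nat.dvd_lcm_right _ _).trans (Nat.dvd_lcm_right _ _)
  set T := {p : ℕ | p < q ∧ p.Prime ∧ ¬p ∣ 2 * m} with hT
  have hTfin : T.Finite := (Set.finite_Iio q).subset fun p hp => hp.1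
  have hqT : q ∉ T := fun h => lt_irrefl q h.1
  have h1T : 1 ∉ insert q T := by
    rintro (h | h)
    · exact hqp.one_lt.ne h
    · exact Nat.not_prime_one h.2.1
  have hScard : (insert 1 (insert q T)).ncard = r + 1 := by
    rw [Set.ncard_insert_of_notMem h1T (hTfin.insert q), Set.ncard_insert_of_notMem hqT hTfin,
      hcard]
  have hS : ∀ k ∈ insert 1 (insert q T), k.Coprime (2 * m) ∧ k ≤ q := by
    rintro k (rfl | rfl | hk)
    · exact ⟨Nat.coprime_one_left _, hqp.one_lt.le⟩
    · exact ⟨(Nat.Prime.coprime_iff_not_dvd hqp).2 hqn, le_rfl⟩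
    · exact ⟨(Nat.Prime.coprime_iff_not_dvd hk.2.1).2 hk.2.2, hk.1.le⟩
  have hsplit : ∀ k ∈ insert 1 (insert q T), ∃ σ : invariantTraceField a b c →+* ℝ,
      IsSplitAt (quaternionAlg a b c) σ ∧
      ∀ z : invariantTraceField a b c, (z : ℝ) = lam 1 c ^ 2 - 2 → σ z = lam k c ^ 2 - 2 := by
    intro k hk
    obtain ⟨hco, hkq⟩ := hS k hk
    have hco' : k.Coprime m := hco.coprime_mul_left_right
    exact exists_isSplitAt hm0 ham hbm hcm hco ha hb hc hyp (kappa_one_pos hyp)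
      (H k (hco'.coprime_dvd_right ham) (hco'.coprime_dvd_right hbm) hkq)
  have : Nonempty (invariantTraceField a b c →+* ℝ) := ⟨algebraMap _ _⟩
  choose! σ hσ hσz using hsplit
  -- `Set.ncard` is 0 on infinite sets, so a count r ≥ 1 forces finiteness.
  have hfin : {σ : invariantTraceField a b c →+* ℝ |
      IsSplitAt (quaternionAlg a b c) σ}.Finite :=
    Set.finite_of_ncard_pos (by rw [adim] at hdim; omega)
  have hle := Set.ncard_le_ncard_of_injOn σ hσ (fun k hk l hl hkl => by
    apply lam_sq_injOn hqp.pos hqc (hS k hk).2 (hS l hl).2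
    have hz := lam_sq_sub_two_mem (c := c) ha (by omega : 2 ≤ b) hyp
    have e1 := hσz k hk ⟨_, hz⟩ rfl
    have e2 := hσz l hl ⟨_, hz⟩ rfl
    change lam k c ^ 2 - 2 = lam l c ^ 2 - 2
    rw [← e1, ← e2, hkl]) hfin
  rw [hScard] at hle
  rw [adim] at hdim
  omega

theorem three_le_of_chi_neg {a b c : ℕ} (ha : 2 ≤ a) (hab : a ≤ b) (hyp : chi a b c < 0) :
    3 ≤ b := by
  by_contra! h
  obtain rfl : a = 2 := by omega
  obtain rfl : b = 2 := by omega
  have : (0 : ℝ) ≤ 1 / c := by positivity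
  rw [chi] at hyp
  norm_num at hyp this
  linarith

theorem mul_pi_div_le {k q s N : ℕ} (hs : 0 < s) (hN : 0 < N) (hk : k ≤ q) (h : q * N ≤ s) :
    k * Real.pi / s ≤ Real.pi / N := by
  have hs' : (0 : ℝ) < s := by exact_mod_cast hs
  have hN' : (0 : ℝ) < N := by exact_mod_cast hN
  have h' : (k : ℝ) * N ≤ s := by exact_mod_cast (Nat.mul_le_mul_right N hk).trans h
  rw [div_le_div_iff₀ hs' hN']
  nlinarith [Real.pi_pos]

end TriangleGroup

end

/-! ### The three bounds -/

theorem proposition4p6 (r a b c q : ℕ) (hr : 1 ≤ r)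
    (ha : 2 ≤ a) (hab : a ≤ b) (hbc : b ≤ c)
    (hyp : TriangleGroup.chi a b c < 0)
    (hdim : TriangleGroup.adim a b c = r)
    (hq : TriangleGroup.IsNondividingPrime (2 * Nat.lcm a (Nat.lcm b c)) r q) :
    a < 3 * q ∧ b < 6 * q ^ 2 ∧ c < 18 * q ^ 4 := by
  have hb := TriangleGroup.three_le_of_chi_neg ha hab hyp
  have hq0 : 0 < q := hq.1.pos
  have H := TriangleGroup.not_forall_kappa_nonneg hr ha hb (hb.trans hbc) hyp hdim hq
  have hqq : q ≤ q ^ 2 := Nat.le_self_pow two_ne_zero q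
  have hqq' : q ≤ q ^ 4 := Nat.le_self_pow four_ne_zero q
  have h1 : a < 3 * q := by
    by_contra! h
    refine H (by omega) fun k _ _ hk => ?_
    -- All three angles are at most π/3, so the angles at b and c sum to at most π minus the angle
    -- at a.
    have ka := TriangleGroup.mul_pi_div_le (s := a) (N := 3) (by omega) (by omega) hk (by omega)
    have kb := TriangleGroup.mul_pi_div_le (s := b) (N := 3) (by omega) (by omega) hk (by omega)
    have kc := TriangleGroup.mul_pi_div_le (s := c) (N := 3) (by omega) (by omega) hk (by omega)
    have hπ := Real.pi_pos
    push_cast at ka kb kc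
    refine TriangleGroup.kappa_nonneg_of_cos (by linarith) ?_
    have := Real.cos_le_cos_of_nonneg_of_le_pi (x := k * Real.pi / b + k * Real.pi / c)
      (y := Real.pi - k * Real.pi / a) (by positivity)
      (by linarith [show 0 ≤ k * Real.pi / a by positivity]) (by linarith)
    rw [Real.cos_pi_sub] at this
    linarith
  have h2 : b < 6 * q ^ 2 := by
    by_contra! h
    refine H (by omega) fun k hka _ hk => ?_
    -- From a < 3q: 2aq ≤ 6q² ≤ b, so the angles at b and c are each at most π/(2a).
    have hN : q * (2 * a) ≤ b := by nlinarith
    have kb := TriangleGroup.mul_pi_div_le (s := b) (N := 2 * a) (by omega) (by omega) hk hN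
    have kc := TriangleGroup.mul_pi_div_le (s := c) (N := 2 * a) (by omega) (by omega) hk
      (hN.trans hbc)
    refine TriangleGroup.kappa_nonneg_of_add_le ha hka ?_
    have e : Real.pi / a = Real.pi / (2 * a : ℕ) + Real.pi / (2 * a : ℕ) := by
      push_cast
      ring
    linarith
  refine ⟨h1, h2, ?_⟩
  by_contra! h
  refine H (by omega) fun k hka hkb hk => ?_
  -- The first two bounds give ab ≤ 18q³, hence q·ab ≤ 18q⁴ ≤ c.
  have hab' : a * b ≤ 3 * q * (6 * q ^ 2) := Nat.mul_le_mul h1.le h2.le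
  have kc := TriangleGroup.mul_pi_div_le (s := c) (N := a * b) (by omega) (by positivity) hk
    (by nlinarith)
  push_cast at kc
  exact TriangleGroup.kappa_nonneg_of_le ha hb (Nat.Coprime.mul_right hka hkb) kc
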